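/- **Definitions.** A *$\ast$-category* is a category with a choice of morphism $f^\ast\colon Y\to X$ for each morphism $f\colon X\to Y$ such that $1^\ast=1$, $(gf)^\ast=f^\ast g^\ast$ and $(f^\ast)^\ast=f$. A morphism $f$ is *isometric* if $f^\ast f=1$ and *coisometric* if $ff^\ast=1$. In a $\ast$-category with a zero object, a binary product $(r_1\colon P\to X,\ r_2\colon P\to Y)$ is *orthonormal* if $r_1,r_2$ are coisometric and $r_1r_2^\ast=0$. A *pre-Hilbert $\ast$-category* is a $\ast$-category with a zero object in which every pair of objects has an orthonormal product, every morphism has an isometric kernel, and, for every object $X$ and orthonormal product $X\oplus X$, the diagonal $\langle 1,1\rangle\colon X\to X\oplus X$ is a kernel of some morphism. Such a category is canonically enriched in abelian groups, with $f+g$ the composite $X\xrightarrow{\langle 1,1\rangle}X\oplus X\xrightarrow{[f,g]}Y$. An *ordered $\ast$-ring* is a $\ast$-ring $R$ in which $r^\ast r=0$ implies $r=0$, together with a partial order on its set of Hermitian elements ($a^\ast=a$) such that $0\le 1$, and $a\le b$ implies $r^\ast ar+c\le r^\ast br+c$ for all Hermitian $a,b,c$ and all $r\in R$. It is *monotone complete*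 if, for every non-empty directed preordered set $J$ and every family $(a_j)_{j\in J}$ of Hermitian elements with $a_j\le a_k$ whenever $j\le k$, if the family has a Hermitian upper bound then it has a supremum among the Hermitian elements. For each object $A$ of a pre-Hilbert $\ast$-category $\mathcal C$, the ring $\mathcal C(A,A)$ is an ordered $\ast$-ring, where $f\le g$ if and only if $g-f=h^\ast h$ for some object $X$ and some morphism $h\colon A\to X$. A morphism $f$ in a pre-Hilbert $\ast$-category is a *contraction* if $f^\ast f\le 1$. Let $(f_{j\le k}\colon X_k\to X_j)_{j\le k\text{ in }J}$ be a diagram of contractions indexed by a non-empty directed preordered set $J$ (so $f_{j\le j}=1$ and $f_{j\le k}f_{k\le l}=f_{j\le l}$); this is a *codirected diagram of contractions*. A cone $(g_j\colon Y\to X_j)_{j\in J}$ on it (that is, $f_{j\le k}g_k=g_j$ for $j\le k$) is an *$\ell^2$-cone* if the family $(g_j^\ast g_j)_{j\in J}$ in $\mathcal C(Y,Y)$ is bounded above. An *$\ell^2$-limit* of the diagram is an $\ell^2$-cone $(f_j\colon X\to X_j)_{j\in J}$ such that, for every $\ell^2$-cone $(g_j\colon Y\to X_j)_{j\in J}$,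 there is a unique morphism $g\colon Y\to X$ with $f_jg=g_j$ for all $j\in J$, and this $g$ satisfies $g^\ast g=\sup_{j\in J}g_j^\ast g_j$. A *Hilbert $\ast$-category* is a pre-Hilbert $\ast$-category in which every codirected diagram of contractions has an $\ell^2$-limit. **Theorem.** Every Hilbert $\ast$-category $\mathcal C$ is monotone complete: for every object $A$ of $\mathcal C$, the ordered $\ast$-ring $\mathcal C(A,A)$ is monotone complete. -/

import Mathlib

open CategoryTheory CategoryTheory.Limits Opposite

universe w v u

/-! ### Ordered ∗-rings -/

/-- An ordered ∗-ring: an anisotropic ∗-ring `R` with a partial order on its set `selfAdjoint R`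
of Hermitian elements such that `0 ≤ 1`, and `a ≤ b` implies `r⋆ a r + c ≤ r⋆ b r + c`. -/
class OrderedStarRing (R : Type v) [Ring R] [StarRing R] extends
    PartialOrder (selfAdjoint R) where
  anisotropic : ∀ r : R, star r * r = 0 → r = 0
  zero_le_one : (0 : selfAdjoint R) ≤ 1
  conj_add_le_conj_add : ∀ (a b c : selfAdjoint R) (r : R), a ≤ b →
    (⟨star r * a * r, IsSelfAdjoint.conjugate' a.2 r⟩ + c : selfAdjoint R) ≤
      ⟨star r * b * r, IsSelfAdjoint.conjugate' b.2 r⟩ + c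

/-- An ordered ∗-ring is monotone complete if every increasing net of Hermitian elements
with an upper bound has a supremum (among the Hermitian elements). -/
def OrderedStarRing.IsMonotoneComplete (R : Type v) [Ring R] [StarRing R] [OrderedStarRing R] :
    Prop :=
  ∀ (J : Type w) [Preorder J] [Nonempty J] [IsDirectedOrder J] (a : J → selfAdjoint R),
    Monotone a → BddAbove (Set.range a) → ∃ s : selfAdjoint R, IsLUB (Set.range a) s

/-! ### ∗-categories -/

/-- A ∗-category: a category with a contravariant involution that fixes the objects. -/
class StarCategory (C : Type u) [Category.{v} C] where
  /-- The morphism `f⋆ : Y ⟶ X` associated with `f : X ⟶ Y`. -/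
  adj : ∀ {X Y : C}, (X ⟶ Y) → (Y ⟶ X)
  adj_id : ∀ X : C, adj (𝟙 X) = 𝟙 X
  adj_comp : ∀ {X Y Z : C} (f : X ⟶ Y) (g : Y ⟶ Z), adj (f ≫ g) = adj g ≫ adj f
  adj_adj : ∀ {X Y : C} (f : X ⟶ Y), adj (adj f) = f

namespace StarCategory

attribute [simp] adj_id adj_comp adj_adj

variable {C : Type u} [Category.{v} C] [StarCategory C]

/-- A morphism `f` is isometric if `f⋆ f = 1`. -/
def IsIsometric {X Y : C} (f : X ⟶ Y) : Prop := f ≫ adj f = 𝟙 X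

/-- A morphism `f` is coisometric if `f f⋆ = 1`. -/
def IsCoisometric {X Y : C} (f : X ⟶ Y) : Prop := adj f ≫ f = 𝟙 Y

end StarCategory

open StarCategory

section PreHilbert

-- The zero morphism `X ⟶ Y` is the composite through the zero object.
attribute [local instance] HasZeroObject.zeroMorphismsOfZeroObject

/-- A span `(r₁, r₂)` is an orthonormal product if it is a product, `r₁` and `r₂` are
coisometric, and `r₁ r₂⋆ = 0`. -/
structure StarCategory.IsOrthonormalProduct {C : Type u} [Category.{v} C] [StarCategory C]
    [HasZeroObject C] {P X Y : C} (r₁ : P ⟶ X) (r₂ : P ⟶ Y) : Prop where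
  isLimit : Nonempty (IsLimit (BinaryFan.mk r₁ r₂))
  coisometric_fst : IsCoisometric r₁
  coisometric_snd : IsCoisometric r₂
  orthogonal : adj r₂ ≫ r₁ = 0

/-- A pre-Hilbert ∗-category: a ∗-category with a zero object, binary orthonormal products
and isometric kernels, in which every diagonal `⟨1, 1⟩ : X ⟶ X ⊕ X` (for `X ⊕ X` an orthonormal
product) is a kernel. -/
class PreHilbertStarCategory (C : Type u) [Category.{v} C] [StarCategory C] : Prop
    extends HasZeroObject C where
  exists_orthonormalProduct : ∀ X Y : C, ∃ (P : C) (r₁ : P ⟶ X) (r₂ : P ⟶ Y),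
    IsOrthonormalProduct r₁ r₂
  exists_isometric_kernel : ∀ {X Y : C} (f : X ⟶ Y), ∃ (K : C) (k : K ⟶ X) (h : k ≫ f = 0),
    Nonempty (IsLimit (KernelFork.ofι k h)) ∧ IsIsometric k
  diagonal_isKernel : ∀ {P X : C} (r₁ r₂ : P ⟶ X), IsOrthonormalProduct r₁ r₂ →
    ∀ d : X ⟶ P, d ≫ r₁ = 𝟙 X → d ≫ r₂ = 𝟙 X →
      ∃ (Y : C) (f : P ⟶ Y) (h : d ≫ f = 0), Nonempty (IsLimit (KernelFork.ofι d h))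

/-! #### The canonical additive structure of a pre-Hilbert ∗-category -/

namespace PreHilbertStarCategory

variable {C : Type u} [Category.{v} C] [StarCategory C] [PreHilbertStarCategory C]

lemma adj_zero (X Y : C) : adj (0 : X ⟶ Y) = 0 := by
  obtain ⟨Z, hZ⟩ := (inferInstance : HasZeroObject C).zero
  have h : (0 : X ⟶ Y) = (0 : X ⟶ Z) ≫ (0 : Z ⟶ Y) := by simp
  rw [h, adj_comp, hZ.eq_of_tgt (adj (0 : Z ⟶ Y)) 0, zero_comp]

lemma adj_eq_zero {X Y : C} {f : X ⟶ Y} (h : adj f = 0) : f = 0 := by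
  rw [← adj_adj f, h, adj_zero]

lemma exists_isBilimit (X Y : C) : ∃ b : BinaryBicone X Y, Nonempty b.IsBilimit := by
  obtain ⟨P, r₁, r₂, ⟨hs⟩, h1, h2, h3⟩ := exists_orthonormalProduct X Y
  have h4 : adj r₁ ≫ r₂ = 0 := adj_eq_zero (by simpa using h3)
  obtain ⟨l, hl⟩ : ∃ l : ∀ {T : C} (_ : T ⟶ X) (_ : T ⟶ Y), T ⟶ P,
      ∀ {T : C} (f : T ⟶ X) (g : T ⟶ Y), l f g ≫ r₁ = f ∧ l f g ≫ r₂ = g :=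
    ⟨fun f g => (BinaryFan.IsLimit.lift' hs f g).1,
      fun f g => (BinaryFan.IsLimit.lift' hs f g).2⟩
  have ext {T : C} {f g : T ⟶ P} (h : f ≫ r₁ = g ≫ r₁) (h' : f ≫ r₂ = g ≫ r₂) : f = g :=
    BinaryFan.IsLimit.hom_ext hs h h'
  refine ⟨⟨P, r₁, r₂, adj r₁, adj r₂, h1, h4, h3, h2⟩, ⟨⟨hs, ?_⟩⟩⟩
  refine BinaryCofan.IsColimit.mk _ (fun f g => adj (l (adj f) (adj g))) ?_ ?_ ?_
  · intro T f g
    have := congrArg adj (hl (adj f) (adj g)).1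
    simpa using this
  · intro T f g
    have := congrArg adj (hl (adj f) (adj g)).2
    simpa using this
  · intro T f g (m : P ⟶ T) hf hg
    replace hf : adj r₁ ≫ m = f := hf
    replace hg : adj r₂ ≫ m = g := hg
    rw [← adj_adj m]
    congr 1
    apply ext
    · simp [(hl _ _).1, ← hf]
    · simp [(hl _ _).2, ← hg]

lemma exists_lift {X Y Z K : C} {f : X ⟶ Y} {k : K ⟶ X} {h : k ≫ f = 0}
    (hl : IsLimit (KernelFork.ofι k h)) (z : Z ⟶ X) (hz : z ≫ f = 0) : ∃ y : Z ⟶ K, y ≫ k = z := by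
  obtain ⟨y, hy⟩ := KernelFork.IsLimit.lift' hl z hz
  exact ⟨y, hy⟩

lemma hasBinaryBiproducts : HasBinaryBiproducts C where
  has_binary_biproduct X Y := by
    obtain ⟨b, ⟨hb⟩⟩ := exists_isBilimit X Y
    exact ⟨⟨b, hb⟩⟩

lemma eq_zero_of_comp_adj {X Y : C} {f : X ⟶ Y} (h : f ≫ adj f = 0) : f = 0 := by
  obtain ⟨K, k, hk, ⟨hl⟩, hi⟩ := exists_isometric_kernel (adj f)
  obtain ⟨q, hq⟩ := KernelFork.IsLimit.lift' hl f h
  replace hq : q ≫ k = f := hq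
  have h1 : k ≫ adj k ≫ adj q = 0 := by
    rw [← adj_comp, hq, hk]
  have h2 : adj q = 0 := by
    rw [← Category.assoc, hi, Category.id_comp] at h1
    exact h1
  rw [← hq, adj_eq_zero h2, zero_comp]

section Add

attribute [local instance] hasBinaryBiproducts
  SemiadditiveOfBinaryBiproducts.addCommMonoidHomOfHasBinaryBiproducts

open SemiadditiveOfBinaryBiproducts

lemma biprod_total (X Y : C) :
    (biprod.fst ≫ biprod.inl + biprod.snd ≫ biprod.inr : X ⊞ Y ⟶ X ⊞ Y) = 𝟙 _ := by
  ext <;> simp [comp_add]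

lemma desc_eq {X Y Z : C} (f : X ⟶ Z) (g : Y ⟶ Z) :
    biprod.desc f g = biprod.fst ≫ f + biprod.snd ≫ g := by
  ext <;> simp [comp_add]

lemma adj_add {X Y : C} (f g : X ⟶ Y) : adj (f + g) = adj f + adj g := by
  have ext {Z : C} {p q : X ⊞ X ⟶ Z} (h₁ : adj biprod.fst ≫ p = adj biprod.fst ≫ q)
      (h₂ : adj biprod.snd ≫ p = adj biprod.snd ≫ q) : p = q := by
    rw [← adj_adj p, ← adj_adj q]
    congr 1
    apply biprod.hom_ext
    · simpa using congrArg adj h₁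
    · simpa using congrArg adj h₂
  have h : adj (biprod.inl : X ⟶ X ⊞ X) ≫ adj biprod.fst
      + adj (biprod.inr : X ⟶ X ⊞ X) ≫ adj biprod.snd = 𝟙 _ := by
    apply ext <;> simp only [comp_add, ← adj_comp] <;> simp [adj_zero]
  have h' : adj (biprod.lift (𝟙 X) (𝟙 X)) = adj biprod.inl + adj biprod.inr := by
    rw [← Category.id_comp (adj (biprod.lift (𝟙 X) (𝟙 X))), ← h]
    simp only [add_comp, ← adj_comp]
    simp
  rw [add_eq_right_addition f g, adj_comp, h', comp_add, ← adj_comp, ← adj_comp]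
  simp

/-- If the only `z` with `z p⋆ = 0` is zero and `p` is idempotent, then `p = 1`. -/
lemma eq_id_of_idem {X : C} {p : X ⟶ X} (hp : p ≫ p = p)
    (h : ∀ {Z : C} (z : Z ⟶ X), z ≫ adj p = 0 → z = 0) : p = 𝟙 X := by
  obtain ⟨P, r₁, r₂, hr⟩ := exists_orthonormalProduct X X
  obtain ⟨hs⟩ := hr.isLimit
  have ext {T : C} {f g : T ⟶ P} (h : f ≫ r₁ = g ≫ r₁) (h' : f ≫ r₂ = g ≫ r₂) : f = g :=
    BinaryFan.IsLimit.hom_ext hs h h'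
  obtain ⟨d, hd₁, hd₂⟩ : ∃ d : X ⟶ P, d ≫ r₁ = 𝟙 X ∧ d ≫ r₂ = 𝟙 X :=
    ⟨_, (BinaryFan.IsLimit.lift' hs (𝟙 X) (𝟙 X)).2⟩
  obtain ⟨l, hl₁, hl₂⟩ : ∃ d : X ⟶ P, d ≫ r₁ = 𝟙 X ∧ d ≫ r₂ = p :=
    ⟨_, (BinaryFan.IsLimit.lift' hs (𝟙 X) p).2⟩
  obtain ⟨Y, m, hm, ⟨hk⟩⟩ := diagonal_isKernel r₁ r₂ hr d hd₁ hd₂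
  have h1 : p ≫ l = p ≫ d := by
    apply ext <;> simp [hl₁, hl₂, hd₁, hd₂, hp]
  have h2 : l ≫ m = 0 := by
    apply adj_eq_zero
    apply h
    rw [← adj_comp, ← Category.assoc, h1, Category.assoc, hm, comp_zero, adj_zero]
  obtain ⟨y, hy⟩ := exists_lift hk l h2
  have h3 : y = 𝟙 X := by rw [← hl₁, ← hy, Category.assoc, hd₁, Category.comp_id]
  rw [← hl₂, ← hy, h3, Category.id_comp, hd₂]

lemma exists_neg_id (X : C) : ∃ n : X ⟶ X, n + 𝟙 X = 0 := by
  obtain ⟨P, r₁, r₂, hr⟩ := exists_orthonormalProduct X X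
  obtain ⟨hs⟩ := hr.isLimit
  obtain ⟨d, hd₁, hd₂⟩ : ∃ d : X ⟶ P, d ≫ r₁ = 𝟙 X ∧ d ≫ r₂ = 𝟙 X :=
    ⟨_, (BinaryFan.IsLimit.lift' hs (𝟙 X) (𝟙 X)).2⟩
  obtain ⟨Y, m, hm, ⟨hd⟩⟩ := diagonal_isKernel r₁ r₂ hr d hd₁ hd₂
  obtain ⟨E, e, he, ⟨hle⟩, hie⟩ := exists_isometric_kernel m
  obtain ⟨K, k, hk, ⟨hlk⟩, hik⟩ := exists_isometric_kernel (adj e)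
  unfold IsIsometric at hie hik
  have hk' : e ≫ adj k = 0 := adj_eq_zero (by simpa using hk)
  have key : adj e ≫ e + adj k ≫ k = 𝟙 P := by
    have h₁ : (adj e ≫ e + adj k ≫ k) ≫ adj e = adj e := by
      simp [add_comp, hie, hk]
    have h₂ : (adj e ≫ e + adj k ≫ k) ≫ adj k = adj k := by
      simp [add_comp, hik, hk']
    apply eq_id_of_idem
    · rw [comp_add, ← Category.assoc, ← Category.assoc, h₁, h₂]
    · intro Z z hz
      have hz' : z ≫ (adj e ≫ e + adj k ≫ k) = 0 := by simpa [adj_add] using hz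
      have h3 : z ≫ adj e = 0 := by rw [← h₁, ← Category.assoc, hz', zero_comp]
      have h4 : z ≫ adj k = 0 := by rw [← h₂, ← Category.assoc, hz', zero_comp]
      obtain ⟨y, hy⟩ := exists_lift hlk z h3
      rw [← hy, Category.assoc, hik, Category.comp_id] at h4
      rw [← hy, h4, zero_comp]
  obtain ⟨c, hc⟩ := exists_lift hle d hm
  obtain ⟨c', hc'⟩ := exists_lift hd e he
  have e1 : e ≫ r₁ = c' := by rw [← hc', Category.assoc, hd₁, Category.comp_id]
  have e2 : e ≫ r₂ = c' := by rw [← hc', Category.assoc, hd₂, Category.comp_id]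
  have h1 : c ≫ c' = 𝟙 X := by rw [← e1, ← Category.assoc, hc, hd₁]
  have h2 : c' ≫ c = 𝟙 E := by
    have : (c' ≫ c) ≫ e = e := by rw [Category.assoc, hc, hc']
    rw [← Category.comp_id (c' ≫ c), ← hie, ← Category.assoc, this]
  have h1' : adj c' ≫ adj c = 𝟙 X := by rw [← adj_comp, h1, adj_id]
  have h2' : adj c ≫ adj c' = 𝟙 E := by rw [← adj_comp, h2, adj_id]
  have h3 : adj c' ≫ c' + (adj r₁ ≫ adj k) ≫ k ≫ r₂ = 0 := by
    have h : adj r₁ ≫ (adj e ≫ e + adj k ≫ k) ≫ r₂ = 0 := by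
      rw [key, Category.id_comp]
      exact adj_eq_zero (by simpa using hr.orthogonal)
    rw [← h, add_comp, comp_add]
    congr 1
    · rw [Category.assoc, e2, ← Category.assoc, ← adj_comp, e1]
    · simp
  refine ⟨c ≫ adj c ≫ (adj r₁ ≫ adj k) ≫ k ≫ r₂, ?_⟩
  have h4 : c ≫ adj c ≫ (adj c' ≫ c') = 𝟙 X := by
    rw [← Category.assoc (adj c), h2', Category.id_comp, h1]
  rw [add_comm, ← h4, ← comp_add, ← comp_add, h3, comp_zero, comp_zero]

variable (C) in
/-- The unique enrichment of a pre-Hilbert ∗-category in abelian groups: the sum `f + g` is the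
composite of `⟨1, 1⟩ : X ⟶ X ⊞ X` and `[f, g] : X ⊞ X ⟶ Y`. -/
noncomputable instance instPreadditive : Preadditive C where
  homGroup X Y :=
    { addCommMonoidHomOfHasBinaryBiproducts X Y with
      neg f := f ≫ (exists_neg_id Y).choose
      zsmul := letI : Neg (X ⟶ Y) := ⟨fun f => f ≫ (exists_neg_id Y).choose⟩; zsmulRec
      neg_add_cancel f := by
        have h := (exists_neg_id Y).choose_spec
        have h' := comp_add f (exists_neg_id Y).choose (𝟙 Y)
        rw [h, comp_zero, Category.comp_id] at h'
        exact h'.symm }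
  add_comp _ _ _ := add_comp
  comp_add _ _ _ := comp_add

end Add

lemma adj_add' {X Y : C} (f g : X ⟶ Y) : adj (f + g) = adj f + adj g := adj_add f g

end PreHilbertStarCategory

end PreHilbert

/-! #### The ordered ∗-rings of endomorphisms -/

namespace PreHilbertStarCategory

variable {C : Type u} [Category.{v} C] [StarCategory C] [PreHilbertStarCategory C]

/-- The endomorphisms of an object form a ∗-ring; in `End A`, the product `f * g` is the
composite `g ≫ f`. -/
noncomputable instance instStarRing (A : C) : StarRing (End A) where
  star f := adj f
  star_involutive f := adj_adj f
  star_mul f g := adj_comp g f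
  star_add f g := adj_add' f g

lemma isSelfAdjoint_comp_adj {A X : C} (f : A ⟶ X) :
    IsSelfAdjoint (R := End A) (f ≫ adj f) := by
  change adj (f ≫ adj f) = _
  simp

/-- The Hermitian endomorphism `f⋆ f` of `A` associated with `f : A ⟶ X`. -/
noncomputable def gram {A X : C} (f : A ⟶ X) : selfAdjoint (End A) :=
  ⟨f ≫ adj f, isSelfAdjoint_comp_adj f⟩

lemma exists_gram_add {A X Y : C} (f : A ⟶ X) (g : A ⟶ Y) :
    ∃ (Z : C) (h : A ⟶ Z), gram h = gram f + gram g := by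
  obtain ⟨P, r₁, r₂, -, h1, h2, h3⟩ := exists_orthonormalProduct X Y
  replace h3 : adj r₂ ≫ r₁ = 0 := h3
  have h4 : adj r₁ ≫ r₂ = 0 := adj_eq_zero (by simpa using h3)
  unfold IsCoisometric at h1 h2
  refine ⟨P, f ≫ adj r₁ + g ≫ adj r₂, Subtype.ext ?_⟩
  change (f ≫ adj r₁ + g ≫ adj r₂) ≫ adj (f ≫ adj r₁ + g ≫ adj r₂) = f ≫ adj f + g ≫ adj g
  simp [adj_add', reassoc_of% h1, reassoc_of% h2, reassoc_of% h3, reassoc_of% h4]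

lemma gram_zero (A X : C) : gram (0 : A ⟶ X) = 0 :=
  Subtype.ext (zero_comp : (0 : A ⟶ X) ≫ adj (0 : A ⟶ X) = 0)

lemma eq_zero_of_gram_eq_zero {A X : C} {f : A ⟶ X} (h : gram f = 0) : f = 0 :=
  eq_zero_of_comp_adj (congrArg Subtype.val h)

lemma gram_eq_zero_of_add_eq_zero {A X Y : C} {f : A ⟶ X} {g : A ⟶ Y}
    (h : gram f + gram g = 0) : gram f = 0 := by
  obtain ⟨P, r₁, r₂, -, h1, h2, h3⟩ := exists_orthonormalProduct X Y
  replace h3 : adj r₂ ≫ r₁ = 0 := h3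
  have h4 : adj r₁ ≫ r₂ = 0 := adj_eq_zero (by simpa using h3)
  unfold IsCoisometric at h1 h2
  have h5 : gram (f ≫ adj r₁ + g ≫ adj r₂) = 0 := by
    rw [← h]
    refine Subtype.ext ?_
    change (f ≫ adj r₁ + g ≫ adj r₂) ≫ adj (f ≫ adj r₁ + g ≫ adj r₂) = f ≫ adj f + g ≫ adj g
    simp [adj_add', reassoc_of% h1, reassoc_of% h2, reassoc_of% h3, reassoc_of% h4]
  have h6 : (f ≫ adj r₁ + g ≫ adj r₂) ≫ r₁ = 0 := by
    rw [eq_zero_of_gram_eq_zero h5, zero_comp]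
  have h7 : f = 0 := by simpa [h1, h3] using h6
  rw [h7, gram_zero]

/-- The canonical order on Hermitian endomorphisms: `f ≤ g` if and only if `g - f = h⋆ h` for some
morphism `h` out of `A`. -/
noncomputable instance instOrderedStarRing (A : C) : OrderedStarRing (End A) where
  le f g := ∃ (X : C) (h : A ⟶ X), g - f = gram h
  le_refl f := ⟨A, 0, by rw [gram_zero, sub_self]⟩
  le_trans f g k := by
    rintro ⟨X, x, hx⟩ ⟨Y, y, hy⟩
    obtain ⟨Z, z, hz⟩ := exists_gram_add y x
    exact ⟨Z, z, by rw [hz, ← hx, ← hy, sub_add_sub_cancel]⟩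
  le_antisymm f g := by
    rintro ⟨X, x, hx⟩ ⟨Y, y, hy⟩
    have h : gram y = 0 := gram_eq_zero_of_add_eq_zero (g := x) (by rw [← hx, ← hy]; abel)
    exact sub_eq_zero.1 (hy.trans h)
  anisotropic r hr := eq_zero_of_comp_adj hr
  zero_le_one := ⟨A, 𝟙 A, Subtype.ext (by
    change (𝟙 A - 0 : A ⟶ A) = 𝟙 A ≫ adj (𝟙 A)
    simp)⟩
  conj_add_le_conj_add a b c r := by
    rintro ⟨X, x, hx⟩
    refine ⟨X, r ≫ x, Subtype.ext ?_⟩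
    replace hx : (b : End A) - (a : End A) = x ≫ adj x := congrArg Subtype.val hx
    change (star r * b * r + c : End A) - (star r * a * r + c) = (r ≫ x) ≫ adj (r ≫ x)
    rw [add_sub_add_right_eq_sub, ← sub_mul, ← mul_sub, hx]
    change r ≫ (x ≫ adj x) ≫ adj r = _
    simp

/-- A morphism `f` is a contraction if `f⋆ f ≤ 1`. -/
def IsContraction {X Y : C} (f : X ⟶ Y) : Prop := gram f ≤ 1

/-! ### ℓ²-limits of codirected diagrams and Hilbert ∗-categories -/

section L2

variable {J : Type w} [Preorder J] {F : Jᵒᵖ ⥤ C}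

/-- A cone `(gⱼ : Y ⟶ Xⱼ)` on a codirected diagram is an ℓ²-cone if the net `(gⱼ⋆ gⱼ)` of
Hermitian endomorphisms of `Y` is bounded above. -/
def IsL2Cone (c : Cone F) : Prop :=
  BddAbove (Set.range fun j : J => gram (c.π.app (op j)))

/-- An ℓ²-limit of a codirected diagram is an ℓ²-cone through which every ℓ²-cone `(gⱼ)` factors
by a unique morphism `g`, and `g⋆ g` is the supremum of `(gⱼ⋆ gⱼ)`. -/
structure IsL2Limit (c : Cone F) : Prop where
  isL2Cone : IsL2Cone c
  existsUnique : ∀ d : Cone F, IsL2Cone d →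
    ∃! g : d.pt ⟶ c.pt, ∀ j : J, g ≫ c.π.app (op j) = d.π.app (op j)
  isLUB : ∀ d : Cone F, IsL2Cone d → ∀ g : d.pt ⟶ c.pt,
    (∀ j : J, g ≫ c.π.app (op j) = d.π.app (op j)) →
      IsLUB (Set.range fun j : J => gram (d.π.app (op j))) (gram g)

end L2

end PreHilbertStarCategory

open PreHilbertStarCategory in
/-- A Hilbert ∗-category is a pre-Hilbert ∗-category that has ℓ²-limits of all codirected diagrams
of contractions. The diagrams are indexed by directed sets `J` in a fixed universe, and consist of
objects `Xⱼ` and morphisms `X_k ⟶ X_j` for `j ≤ k`, that is, they are functors `Jᵒᵖ ⥤ C`. -/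
class HilbertStarCategory (C : Type u) [Category.{v} C] [StarCategory C] : Prop
    extends PreHilbertStarCategory C where
  exists_isL2Limit : ∀ (J : Type w) [Preorder J] [Nonempty J] [IsDirectedOrder J] (F : Jᵒᵖ ⥤ C),
    (∀ (j k : J) (h : j ≤ k), IsContraction (F.map (homOfLE h).op)) →
      ∃ c : Cone F, IsL2Limit c

/-- A pre-Hilbert ∗-category is monotone complete if all of its ordered ∗-rings of endomorphisms
are monotone complete. -/
def PreHilbertStarCategory.IsMonotoneComplete (C : Type u) [Category.{v} C] [StarCategory C]
    [PreHilbertStarCategory C] : Prop :=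
  ∀ A : C, OrderedStarRing.IsMonotoneComplete.{w} (End A)

/-! ### Factorising Hermitian endomorphisms above 1 -/

namespace PreHilbertStarCategory

variable {C : Type u} [Category.{v} C] [StarCategory C] [PreHilbertStarCategory C]

/-! The supremum is read off from an ℓ²-limit, so the net has to be realised as the Gram net of a
cone on contractions. If every `a j` is `p j⋆ p j` with `p j : A ≅ E j` invertible, the transition
maps `E k ⟶ E j` are forced to be `p j (p k)⁻¹`. They compose correctly, they are contractions
exactly because `a j ≤ a k`, and the `p j` form an ℓ²-cone because the net is bounded. The morphism
`g` induced into the ℓ²-limit then has `g⋆ g` as the supremum. Invertible factors exist when `a ≥ 1`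
(`exists_iso_gram_eq`): writing `a = 1 + h⋆ h`, the map `⟨1, h⟩` identifies `A` with the graph of
`h`. A general net is brought to this case by restricting to a tail and translating, neither of
which affects the existence of a supremum. -/

lemma gram_comp_of_isIsometric {A X Y : C} (f : A ⟶ X) {e : X ⟶ Y} (he : IsIsometric e) :
    gram (f ≫ e) = gram f := by
  refine Subtype.ext ?_
  change (f ≫ e) ≫ adj (f ≫ e) = f ≫ adj f
  unfold IsIsometric at he
  simp [reassoc_of% he]

/-- Conjugation by the inverse of `p` turns `p⋆ p` into 1, so a witness `z` of the inequality
becomes the witness `p.inv ≫ z`. -/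
lemma isContraction_inv_comp {A X Y : C} (p : A ≅ X) (q : A ≅ Y)
    (h : gram q.hom ≤ gram p.hom) : IsContraction (p.inv ≫ q.hom) := by
  obtain ⟨Z, z, hz⟩ := h
  refine ⟨Z, p.inv ≫ z, Subtype.ext ?_⟩
  replace hz : p.hom ≫ adj p.hom - q.hom ≫ adj q.hom = z ≫ adj z := congrArg Subtype.val hz
  change 𝟙 X - (p.inv ≫ q.hom) ≫ adj (p.inv ≫ q.hom) = (p.inv ≫ z) ≫ adj (p.inv ≫ z)
  have hp : adj p.hom ≫ adj p.inv = 𝟙 X := by rw [← adj_comp, p.inv_hom_id, adj_id]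
  have h1 := congrArg (fun t => p.inv ≫ t ≫ adj p.inv) hz
  simpa [Preadditive.comp_sub, Preadditive.sub_comp, hp] using h1

/-- The graph of a morphism is, up to an isomorphism, an isometry: thus every Hermitian
endomorphism `a ≥ 1` is of the form `u⋆ u` with `u` invertible. -/
lemma exists_iso_gram_eq {A : C} {a : selfAdjoint (End A)} (ha : 1 ≤ a) :
    ∃ (E : C) (u : A ≅ E), gram u.hom = a := by
  obtain ⟨X, h, hh⟩ := ha
  replace hh : 𝟙 A + h ≫ adj h = a.1 :=
    (add_comm _ _).trans (sub_eq_iff_eq_add.1 (congrArg Subtype.val hh)).symm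
  obtain ⟨P, r₁, r₂, ⟨hs⟩, h1, h2, h3⟩ := exists_orthonormalProduct A X
  replace h3 : adj r₂ ≫ r₁ = 0 := h3
  have h4 : adj r₁ ≫ r₂ = 0 := adj_eq_zero (by simpa using h3)
  unfold IsCoisometric at h1 h2
  -- The morphism `adj r₁ + h ≫ adj r₂` is `⟨1, h⟩`; orthonormality of the product gives it Gram
  -- element `1 + h⋆ h`.
  have hd₁ : (adj r₁ + h ≫ adj r₂) ≫ r₁ = 𝟙 A := by simp [h1, h3]
  have hd₂ : (adj r₁ + h ≫ adj r₂) ≫ r₂ = h := by simp [h2, h4]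
  have hd : (gram (adj r₁ + h ≫ adj r₂) : selfAdjoint (End A)) = a := by
    refine Subtype.ext ?_
    change (adj r₁ + h ≫ adj r₂) ≫ adj (adj r₁ + h ≫ adj r₂) = a.1
    rw [← hh]
    simp [adj_add', h1, reassoc_of% h2, h3, reassoc_of% h4]
  generalize adj r₁ + h ≫ adj r₂ = d at hd₁ hd₂ hd
  -- This kernel is the graph of `h`, embedded isometrically. The factorisation `c` of `d` through
  -- it is the required isomorphism, with inverse the first projection `e ≫ r₁`.
  obtain ⟨E, e, he, ⟨hl⟩, hi⟩ := exists_isometric_kernel (r₁ ≫ h - r₂)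
  have hi' : e ≫ adj e = 𝟙 E := hi
  have he' : (e ≫ r₁) ≫ h = e ≫ r₂ := by
    rw [Category.assoc, ← sub_eq_zero, ← Preadditive.comp_sub]
    exact he
  obtain ⟨c, hc⟩ := exists_lift hl d
    (show d ≫ (r₁ ≫ h - r₂) = 0 by rw [Preadditive.comp_sub, reassoc_of% hd₁, hd₂, sub_self])
  have hed : (e ≫ r₁) ≫ d = e := by
    apply BinaryFan.IsLimit.hom_ext hs
    · change ((e ≫ r₁) ≫ d) ≫ r₁ = e ≫ r₁
      simp [hd₁]
    · change ((e ≫ r₁) ≫ d) ≫ r₂ = e ≫ r₂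
      rw [Category.assoc, hd₂, he']
  refine ⟨E, ⟨c, e ≫ r₁, by rw [reassoc_of% hc, hd₁], ?_⟩, ?_⟩
  -- The isometry `e` is a split monomorphism, so it cancels on the right.
  · have h5 : ((e ≫ r₁) ≫ c) ≫ e = e := by rw [Category.assoc, hc, hed]
    rw [← Category.comp_id ((e ≫ r₁) ≫ c), ← hi', ← Category.assoc, h5]
  · change gram c = a
    rw [← hd, ← gram_comp_of_isIsometric c hi, hc]

lemma add_le_add_right_hermitian {A : C} {a b : selfAdjoint (End A)} (h : a ≤ b)
    (c : selfAdjoint (End A)) : a + c ≤ b + c := by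
  obtain ⟨X, x, hx⟩ := h
  exact ⟨X, x, by rw [← hx, add_sub_add_right_eq_sub]⟩

end PreHilbertStarCategory

/-! ### Suprema from ℓ²-limits -/

namespace HilbertStarCategory

open PreHilbertStarCategory

variable {C : Type u} [Category.{v} C] [StarCategory C] [HilbertStarCategory.{w} C]

lemma exists_isLUB_of_one_le {J : Type w} [Preorder J] [Nonempty J] [IsDirectedOrder J] {A : C}
    {a : J → selfAdjoint (End A)} (ha : Monotone a) (hb : BddAbove (Set.range a))
    (h1 : ∀ j, 1 ≤ a j) : ∃ s : selfAdjoint (End A), IsLUB (Set.range a) s := by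
  choose E p hp using fun j => exists_iso_gram_eq (h1 j)
  let F : Jᵒᵖ ⥤ C :=
    { obj := fun j => E j.unop
      map := fun {j k} _ => (p j.unop).inv ≫ (p k.unop).hom }
  obtain ⟨c, hc⟩ := exists_isL2Limit J F fun j k h =>
    isContraction_inv_comp (p k) (p j) (by rw [hp, hp]; exact ha h)
  -- The isomorphisms are themselves the legs of a cone with apex `A`, whose Gram net is `a`.
  let d : Cone F :=
    { pt := A
      π := { app := fun j => (p j.unop).hom } }
  have hd : (fun j => gram (d.π.app (op j))) = a := funext hp
  have hd' : IsL2Cone d := by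
    unfold IsL2Cone
    rwa [hd]
  obtain ⟨g, hg, -⟩ := hc.existsUnique d hd'
  have hs := hc.isLUB d hd' g hg
  rw [hd] at hs
  exact ⟨_, hs⟩

end HilbertStarCategory

theorem mainTheorem1 (C : Type u) [Category.{v} C] [StarCategory C]
    [HilbertStarCategory.{w} C] : PreHilbertStarCategory.IsMonotoneComplete.{w} C := by
  intro A J _ hJ _ a ha ⟨b, hb⟩
  obtain ⟨i⟩ := hJ
  have : Nonempty (Set.Ici i) := ⟨⟨i, le_refl i⟩⟩
  have : IsDirectedOrder (Set.Ici i) := ⟨fun x y => by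
    obtain ⟨z, hxz, hyz⟩ := exists_ge_ge x.1 y.1
    exact ⟨⟨z, le_trans x.2 hxz⟩, hxz, hyz⟩⟩
  -- Adding `1 - a i` sends `a i` to 1, so by monotonicity the tail over `j ≥ i` lies above 1.
  obtain ⟨s, hs⟩ := HilbertStarCategory.exists_isLUB_of_one_le (J := Set.Ici i)
    (a := fun j => a j + (1 - a i))
    (fun j k h => PreHilbertStarCategory.add_le_add_right_hermitian (ha h) _)
    ⟨b + (1 - a i), by
      rintro _ ⟨j, rfl⟩
      exact PreHilbertStarCategory.add_le_add_right_hermitian (hb ⟨j, rfl⟩) _⟩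
    (fun j => by
      simpa using PreHilbertStarCategory.add_le_add_right_hermitian (ha j.2) (1 - a i))
  have hcancel (t : selfAdjoint (End A)) : t + (1 - a i) + (a i - 1) = t := by abel
  refine ⟨s + (a i - 1), ?_, ?_⟩
  · rintro _ ⟨j, rfl⟩
    -- An index `j` need not lie in the tail, but directedness gives a `k` in the tail with `a j ≤ a
    -- k`.
    obtain ⟨k, hjk, hik⟩ := exists_ge_ge j i
    refine (ha hjk).trans ?_
    have h := PreHilbertStarCategory.add_le_add_right_hermitian (hs.1 ⟨⟨k, hik⟩, rfl⟩) (a i - 1)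
    rwa [hcancel] at h
  · intro t ht
    have h : s ≤ t + (1 - a i) := by
      apply hs.2
      rintro _ ⟨j, rfl⟩
      exact PreHilbertStarCategory.add_le_add_right_hermitian (ht ⟨j, rfl⟩) _
    have h' := PreHilbertStarCategory.add_le_add_right_hermitian h (a i - 1)
    rwa [hcancel] at h'
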